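/- **Setting.** Let $\mathcal V$ be a finite-dimensional real vector space, $\|\cdot\|$ a norm on $\mathcal V$, and $\|y\|_*=\sup_{\|x\|\le 1}|\langle y,x\rangle|$ the dual norm on the dual space $\mathcal V^*$. The Decision Maker has a finite set $\mathcal I=\{1,\dots,d\}$ of pure actions, and $\Delta_d$ is the simplex of mixed actions (probability vectors on $\mathcal I$). The Environment has a set $\mathcal B$ of actions, which is a measurable space. Let $r:\mathcal I\times\mathcal B\to\mathcal V^*$ be a payoff function, measurable in its second variable, extended by $r(a,b)=\sum_{i=1}^d a_i\,r(i,b)$ for $a\in\Delta_d$. Let $\mathcal C\subset\mathcal V^*$ be a (nonempty) closed convex cone, with polar cone $\mathcal C^\circ=\{x\in\mathcal V:\langle y,x\rangle\le 0\ \ \forall y\in\mathcal C\}$. Assume that $\mathcal C$ is a B-set, i.e. for every $x\in\mathcal C^\circ$ there is $a\in\Delta_d$ with $\langle r(a,b),x\rangle\le 0$ for all $b\in\mathcal B$, and let $a:\mathcal C^\circ\to\Delta_d$ be an oracle, i.e. a map such that $\langle r(a(x),b),x\rangle\le0$ for all $x\in\mathcal C^\circ$ and $b\in\mathcal B$. Let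 $\mathcal X\subset\mathcal V$ be a generator of $\mathcal C^\circ$: a convex compact set with $\mathbb R_+\mathcal X=\mathcal C^\circ$. Put $\|\mathcal X\|=\sup_{x\in\mathcal X}\|x\|$ and $I^*_{\mathcal X}(y)=\sup_{x\in\mathcal X}\langle y,x\rangle$ for $y\in\mathcal V^*$ (the support function). Let $h:\mathcal V\to\mathbb R\cup\{+\infty\}$ be a regularizer on $\mathcal X$: convex, strictly convex on its domain, lower semicontinuous, and finite exactly on $\mathcal X$. Let $h^*(y)=\sup_{x\in\mathcal V}\{\langle y,x\rangle-h(x)\}$ be its Legendre–Fenchel transform. **Game and algorithm.** Let $(\eta_t)_{t\ge1}$ be positive parameters. At each time $t\ge1$ the Decision Maker computes $$x_t=\nabla h^*\Big(\eta_{t-1}\sum_{s=1}^{t-1}r_s\Big)$$ (the sum being empty, so that $x_1=\nabla h^*(0)$, for $t=1$) and plays the mixed action $a_t=a(x_t)$; the Environment chooses $b_t\in\mathcal B$; a pure action $i_t\sim a_t$ is drawn, and $r_t=r(i_t,b_t)$ is observed. All of $a_t,b_t,i_t$ are random variables on a probability space. The choice of $b_t$ is arbitrary (it may depend on the past, on $a_t$,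 and on private randomness), except that it does not depend on $i_t$: with $\mathcal F_t$ the $\sigma$-algebra generated by $(a_1,b_1,i_1,\dots,a_{t-1},b_{t-1},i_{t-1},a_t,b_t)$, the conditional law of $i_t$ given $\mathcal F_t$ is $a_t$. Write $\bar r_T=\frac1T\sum_{t=1}^T r_t$. **Theorem.** Let $\Delta,M,K>0$ and assume: 1. $\sup_{x\in\mathcal X}h(x)-\inf_{x\in\mathcal X}h(x)\le\Delta$; 2. $h$ is $K$-strongly convex with respect to $\|\cdot\|$: for all $x,x'\in\mathcal V$ and $\lambda\in[0,1]$, $h(\lambda x+(1-\lambda)x')\le\lambda h(x)+(1-\lambda)h(x')-\frac{K\lambda(1-\lambda)}2\|x'-x\|^2$; 3. $\|r(a,b)\|_*\le M$ for all $a\in\Delta_d$ and $b\in\mathcal B$. Then, with $\eta_t=\sqrt{\dfrac{\Delta K}{M^2t}}$ for $t\ge1$, whatever the Environment does: * for all $T\ge1$, $I^*_{\mathcal X}(\bar r_T)$ is integrable and $\displaystyle\mathbb E\big[I^*_{\mathcal X}(\bar r_T)\big]\le 2M\sqrt{\frac{\Delta}{KT}}$; * for all $\delta\in(0,1)$ and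 all $T\ge1$, with probability at least $1-\delta$, $$I^*_{\mathcal X}(\bar r_T)\le\frac{M}{\sqrt T}\Big(2\sqrt{\frac{\Delta}{K}}+\|\mathcal X\|\sqrt{2\log(1/\delta)}\Big);$$ * almost surely, $\displaystyle\limsup_{T\to+\infty}I^*_{\mathcal X}(\bar r_T)\le0$. -/

import Mathlib

open MeasureTheory Filter
open scoped Topology

noncomputable section

namespace Approachability

/-! Throughout, `V` is a finite-dimensional real vector space with a given norm, and its dual `V*` is
`StrongDual ℝ V`, whose norm is the dual norm `‖y‖ = sup {|y x| : ‖x‖ ≤ 1}`. The pairing `⟨y, x⟩` of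
`y` in `V*` and `x` in `V` is `y x`. -/

section Convexity

variable {V : Type*} [NormedAddCommGroup V] [NormedSpace ℝ V]

/-- The polar cone, in `V`, of a subset `S` of `V*`. -/
def polarCone (S : Set (StrongDual ℝ V)) : Set V :=
  {x | ∀ y ∈ S, y x ≤ 0}

/-- `X` is a generator of the cone `D`: it is convex and compact, and `ℝ₊ X = D`. -/
structure IsGenerator (X D : Set V) : Prop where
  convex : Convex ℝ X
  isCompact : IsCompact X
  cone_eq : {z : V | ∃ c : ℝ, 0 ≤ c ∧ ∃ x ∈ X, z = c • x} = D

/-- The support function `y ↦ sup_{x ∈ X} ⟨y, x⟩` of `X`. The set of values is nonempty and bounded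
when `X` is nonempty and compact, so that this supremum is then a genuine one. -/
def supportFun (X : Set V) (y : StrongDual ℝ V) : ℝ :=
  sSup ((fun x => y x) '' X)

/-- The size `‖X‖ = sup_{x ∈ X} ‖x‖` of a (nonempty, bounded) set. -/
def setNorm (X : Set V) : ℝ :=
  sSup ((fun x => ‖x‖) '' X)

/-- `h : V → ℝ ∪ {+∞}` is a regularizer on `X`: it is convex, strictly convex, lower semicontinuous,
and finite exactly on `X`. -/
structure IsRegularizer (X : Set V) (h : V → EReal) : Prop where
  ne_bot : ∀ x, h x ≠ ⊥
  domain_eq : {x | h x ≠ ⊤} = X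
  convex : ∀ x x' : V, ∀ l : ℝ, 0 ≤ l → l ≤ 1 →
    h (l • x + (1 - l) • x') ≤ (l : EReal) * h x + ((1 - l : ℝ) : EReal) * h x'
  strictConvex : ∀ x ∈ X, ∀ x' ∈ X, x ≠ x' → ∀ l : ℝ, 0 < l → l < 1 →
    h (l • x + (1 - l) • x') < (l : EReal) * h x + ((1 - l : ℝ) : EReal) * h x'
  lowerSemicontinuous : LowerSemicontinuous h

/-- `h : V → ℝ ∪ {+∞}` is `K`-strongly convex with respect to the norm of `V`. -/
def IsStronglyConvex (K : ℝ) (h : V → EReal) : Prop :=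
  ∀ x x' : V, ∀ l : ℝ, 0 ≤ l → l ≤ 1 →
    h (l • x + (1 - l) • x') ≤
      (l : EReal) * h x + ((1 - l : ℝ) : EReal) * h x'
        - ((K * l * (1 - l) / 2 * ‖x' - x‖ ^ 2 : ℝ) : EReal)

/-- The Legendre--Fenchel transform `h*(y) = sup_{x ∈ V} (⟨y, x⟩ - h x)`. -/
def conjugate (h : V → EReal) (y : StrongDual ℝ V) : EReal :=
  ⨆ x : V, ((y x : ℝ) : EReal) - h x

/-- The gradient `∇h*(y)` of the Legendre--Fenchel transform (which is real-valued when `h` is a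
regularizer on a nonempty compact set): the derivative of `h*` at `y` is a linear form on `V*`, and
the gradient is the vector of `V` which represents it. -/
def gradConjugate [FiniteDimensional ℝ V] (h : V → EReal) (y : StrongDual ℝ V) : V :=
  (Module.evalEquiv ℝ V).symm
    ((fderiv ℝ (fun z => (conjugate h z).toReal) y : StrongDual ℝ V →ₗ[ℝ] ℝ) ∘ₗ
      (LinearMap.toContinuousLinearMap : (V →ₗ[ℝ] ℝ) ≃ₗ[ℝ] (V →L[ℝ] ℝ)).toLinearMap)

/-- The defining property of the gradient: `⟨z, ∇h*(y)⟩` is the derivative of `h*` at `y` in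
direction `z`. -/
theorem apply_gradConjugate [FiniteDimensional ℝ V] (h : V → EReal) (y z : StrongDual ℝ V) :
    z (gradConjugate h y) = fderiv ℝ (fun z => (conjugate h z).toReal) y z := by
  exact Module.apply_evalEquiv_symm_apply ℝ V (z : V →ₗ[ℝ] ℝ) _

end Convexity

section Game

variable {V : Type*} [NormedAddCommGroup V] [NormedSpace ℝ V] {B : Type*} {d : ℕ}

/-- The linear extension `r(a, b) = ∑ i, a_i r(i, b)` of the payoff function to mixed actions. -/
def mixedPayoff (r : Fin d → B → StrongDual ℝ V) (a : Fin d → ℝ) (b : B) : StrongDual ℝ V :=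
  ∑ i, a i • r i b

/-- Blackwell's condition for the game with mixed actions: the closed convex cone `C` is a B-set,
that is, every half-space bounded by the hyperplane orthogonal to a point of the polar of `C` can be
enforced by a mixed action. -/
def IsBSet (r : Fin d → B → StrongDual ℝ V) (C : ProperCone ℝ (StrongDual ℝ V)) : Prop :=
  ∀ x ∈ polarCone (C : Set (StrongDual ℝ V)),
    ∃ a ∈ stdSimplex ℝ (Fin d), ∀ b : B, mixedPayoff r a b x ≤ 0

/-- `α` is an oracle: it selects, for every point of the polar of `C`, a mixed action as in
Blackwell's condition. Its values outside the polar are irrelevant. -/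
def IsOracle (r : Fin d → B → StrongDual ℝ V) (C : ProperCone ℝ (StrongDual ℝ V))
    (α : V → Fin d → ℝ) : Prop :=
  ∀ x ∈ polarCone (C : Set (StrongDual ℝ V)),
    α x ∈ stdSimplex ℝ (Fin d) ∧ ∀ b : B, mixedPayoff r (α x) b x ≤ 0

variable {Ω : Type*}

/-- The vector payoff `r_t = r(i_t, b_t)`. -/
def payoff (r : Fin d → B → StrongDual ℝ V) (i : ℕ → Ω → Fin d) (b : ℕ → Ω → B)
    (t : ℕ) (ω : Ω) : StrongDual ℝ V :=
  r (i t ω) (b t ω)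

/-- The average payoff `(r_1 + ... + r_T) / T`. -/
def avgPayoff (r : Fin d → B → StrongDual ℝ V) (i : ℕ → Ω → Fin d) (b : ℕ → Ω → B)
    (T : ℕ) (ω : Ω) : StrongDual ℝ V :=
  (T : ℝ)⁻¹ • ∑ t ∈ Finset.Icc 1 T, payoff r i b t ω

/-- The point `x_t = ∇h*(η_{t-1} (r_1 + ... + r_{t-1}))` computed by the FTRL algorithm at time
`t ≥ 1` (the sum is empty for `t = 1`, so that `η_0` plays no role). -/
def ftrlPoint [FiniteDimensional ℝ V] (h : V → EReal) (η : ℕ → ℝ)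
    (r : Fin d → B → StrongDual ℝ V) (i : ℕ → Ω → Fin d) (b : ℕ → Ω → B) (t : ℕ) (ω : Ω) : V :=
  gradConjugate h (η (t - 1) • ∑ s ∈ Finset.Ico 1 t, payoff r i b s ω)

/-- The σ-algebra generated by `(a_1, b_1, i_1, ..., a_{t-1}, b_{t-1}, i_{t-1}, a_t, b_t)`: all that
has happened when the pure action `i_t` is drawn. -/
@[reducible] def history [MeasurableSpace B] (a : ℕ → Ω → Fin d → ℝ) (b : ℕ → Ω → B) (i : ℕ → Ω → Fin d)
    (t : ℕ) : MeasurableSpace Ω :=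
  (⨆ s ∈ Finset.Icc 1 t, MeasurableSpace.comap (a s) inferInstance ⊔
      MeasurableSpace.comap (b s) inferInstance) ⊔
    ⨆ s ∈ Finset.Ico 1 t, MeasurableSpace.comap (i s) inferInstance

/-- The random variables `a_t`, `b_t`, `i_t` (`t ≥ 1`; the index `0` is not used) are a play of the
game with mixed actions in which the Decision Maker uses the FTRL algorithm given by the regularizer
`h`, the parameters `η` and the oracle `α`. Nothing is assumed about the actions `b_t` of the
Environment except that `b_t` is chosen before `i_t` is drawn: given the history up to and including
`a_t` and `b_t`, the pure action `i_t` has law `a_t`. -/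
structure IsFTRLPlay [FiniteDimensional ℝ V] [MeasurableSpace B] [MeasurableSpace Ω]
    (μ : Measure Ω) (r : Fin d → B → StrongDual ℝ V) (h : V → EReal) (η : ℕ → ℝ)
    (α : V → Fin d → ℝ) (a : ℕ → Ω → Fin d → ℝ) (b : ℕ → Ω → B) (i : ℕ → Ω → Fin d) : Prop where
  measurable_mixed : ∀ t, 1 ≤ t → Measurable (a t)
  measurable_env : ∀ t, 1 ≤ t → Measurable (b t)
  measurable_pure : ∀ t, 1 ≤ t → Measurable (i t)
  mixed_eq : ∀ t, 1 ≤ t → ∀ ω, a t ω = α (ftrlPoint h η r i b t ω)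
  pure_law : ∀ t, 1 ≤ t → ∀ j : Fin d,
    μ[(i t ⁻¹' {j}).indicator (fun _ => (1 : ℝ)) | history a b i t] =ᵐ[μ] fun ω => a t ω j

end Game

end Approachability

end

/-!
The proof has a deterministic part and a probabilistic part.

Strong convexity makes `y - h` fall off quadratically away from its maximizer on `X`, so that `h*` has
a first-order expansion with quadratic error and the maximizer as slope
(`StrongConvexOn.sub_le_of_isMaxOn`). Hence `∇h* y` *is* the maximizer
(`IsRegularizer.gradConjugate_eq`); it is a point of `X`, and a Lipschitz function of `y`. The same
expansion bounds the growth of the potential `max_x (⟨y, x⟩ - (h x - min h) / η_t)` in one step, and the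
potential decreases with `η_t`. Summing over time gives the regret bound
`max_x ⟨∑ r_t, x⟩ ≤ ∑ ⟨r_t, x_t⟩ + Δ / η_T + (M² / 2K) (η_1 + ∑_{t < T} η_t)`
(`StrongConvexOn.ftrl_regret_le`), and the choice of `η_t` turns the last two terms into
`2 M √(Δ T / K)` (`regret_bound_le`).

It remains to control `∑ ⟨r_t, x_t⟩`. As `x_t` lies in the polar cone, the oracle makes the conditional
expectation `⟨r(a_t, b_t), x_t⟩` of each term nonpositive, and the terms are bounded by `M ‖X‖`
(`IsFTRLPlay.isSupermartingaleDraw`). So the expectation of the sum is nonpositive, and the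
Azuma--Hoeffding inequality bounds its upper tail
(`IsSupermartingaleDraw.measureReal_lt_sum_le`). The almost sure statement follows from the tail bound
at the levels `1 - 1 / T²` and the Borel--Cantelli lemma.
-/

open MeasureTheory Filter
open scoped Topology

noncomputable section

namespace Approachability

/-! ### Maximizers of a linear form minus a strongly convex function -/

section Maximizers

variable {V : Type*} [NormedAddCommGroup V] [NormedSpace ℝ V] {X : Set V} {g : V → ℝ} {K : ℝ}

/-- A `K`-strongly concave function lies below its maximum by at least a quadratic amount. Here the
function is `y - g` with `y` linear. -/
lemma _root_.StrongConvexOn.add_sq_le_of_isMaxOn (hg : StrongConvexOn X K g)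
    {y : StrongDual ℝ V} {p x : V} (hp : p ∈ X) (hmax : IsMaxOn (fun x => y x - g x) X p) (hx : x ∈ X) :
    y x - g x + K / 2 * ‖x - p‖ ^ 2 ≤ y p - g p := by
  have key : ∀ l ∈ Set.Ioo (0 : ℝ) 1,
      y x - g x + (1 - l) * (K / 2 * ‖x - p‖ ^ 2) ≤ y p - g p := by
    rintro l ⟨hl0, hl1⟩
    have h1 := hg.2 hx hp hl0.le (sub_nonneg.2 hl1.le) (by ring)
    have h2 : y (l • x + (1 - l) • p) - g (l • x + (1 - l) • p) ≤ y p - g p :=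
      hmax (hg.1 hx hp hl0.le (sub_nonneg.2 hl1.le) (by ring))
    simp only [map_add, map_smul, smul_eq_mul] at h1 h2
    refine le_of_mul_le_mul_left ?_ hl0
    linarith
  have hlim : Tendsto (fun l : ℝ => y x - g x + (1 - l) * (K / 2 * ‖x - p‖ ^ 2)) (𝓝[>] 0)
      (𝓝 (y x - g x + (1 - 0) * (K / 2 * ‖x - p‖ ^ 2))) :=
    (Continuous.tendsto (by fun_prop) 0).mono_left nhdsWithin_le_nhds
  have := le_of_tendsto hlim
    (eventually_of_mem (Ioo_mem_nhdsGT (zero_lt_one' ℝ)) key)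
  simpa using this

/-- Moving the linear form from `y` to `z` changes the maximum of `y - g` by the first-order term
`(z - y) p`, up to an error quadratic in `z - y`: `x` loses `K / 2 * ‖x - p‖ ^ 2` by being away from
the maximizer, and gains at most `‖z - y‖ * ‖x - p‖` from the change of linear form. -/
lemma _root_.StrongConvexOn.sub_le_of_isMaxOn (hK : 0 < K) (hg : StrongConvexOn X K g)
    {y : StrongDual ℝ V} {p x : V} (hp : p ∈ X) (hmax : IsMaxOn (fun x => y x - g x) X p)
    (hx : x ∈ X) (z : StrongDual ℝ V) :
    z x - g x ≤ y p - g p + (z - y) p + ‖z - y‖ ^ 2 / (2 * K) := by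
  have h1 := hg.add_sq_le_of_isMaxOn hp hmax hx
  have h2 : (z - y) (x - p) ≤ ‖z - y‖ * ‖x - p‖ :=
    (le_abs_self _).trans ((z - y).le_opNorm (x - p))
  have h3 : ‖z - y‖ * ‖x - p‖ ≤ K / 2 * ‖x - p‖ ^ 2 + ‖z - y‖ ^ 2 / (2 * K) := by
    have : K / 2 * ‖x - p‖ ^ 2 + ‖z - y‖ ^ 2 / (2 * K) - ‖z - y‖ * ‖x - p‖
        = (K * ‖x - p‖ - ‖z - y‖) ^ 2 / (2 * K) := by
      field_simp
      ring
    have : 0 ≤ (K * ‖x - p‖ - ‖z - y‖) ^ 2 / (2 * K) := by positivity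
    linarith
  simp only [map_sub, sub_apply] at h2 ⊢
  linarith

/-- The maximizer of `y - g` is a Lipschitz function of `y`. -/
lemma _root_.StrongConvexOn.norm_sub_le_of_isMaxOn (hK : 0 < K) (hg : StrongConvexOn X K g)
    {y z : StrongDual ℝ V} {p q : V} (hp : p ∈ X) (hpmax : IsMaxOn (fun x => y x - g x) X p)
    (hq : q ∈ X) (hqmax : IsMaxOn (fun x => z x - g x) X q) :
    ‖p - q‖ ≤ K⁻¹ * ‖y - z‖ := by
  have h1 := hg.add_sq_le_of_isMaxOn hp hpmax hq
  have h2 := hg.add_sq_le_of_isMaxOn hq hqmax hp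
  have h3 : (y - z) (p - q) ≤ ‖y - z‖ * ‖p - q‖ :=
    (le_abs_self _).trans ((y - z).le_opNorm (p - q))
  rw [norm_sub_rev q p] at h1
  simp only [map_sub, sub_apply] at h3
  rcases (norm_nonneg (p - q)).eq_or_lt with h0 | h0
  · rw [← h0]
    positivity
  · rw [← div_eq_inv_mul, le_div_iff₀ hK]
    refine le_of_mul_le_mul_right ?_ h0
    linarith

end Maximizers

/-! ### The gradient of the Legendre--Fenchel transform -/

section Regularizer

variable {V : Type*} [NormedAddCommGroup V] [NormedSpace ℝ V] {X : Set V} {h : V → EReal} {K : ℝ}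

lemma IsRegularizer.coe_toReal (hh : IsRegularizer X h) {x : V} (hx : x ∈ X) :
    ((h x).toReal : EReal) = h x :=
  EReal.coe_toReal (by rw [← hh.domain_eq] at hx; exact hx) (hh.ne_bot x)

lemma IsRegularizer.eq_top (hh : IsRegularizer X h) {x : V} (hx : x ∉ X) : h x = ⊤ := by
  rw [← hh.domain_eq] at hx
  simpa using hx

lemma IsRegularizer.strongConvexOn_toReal (hh : IsRegularizer X h) (hX : Convex ℝ X)
    (hconv : IsStronglyConvex K h) : StrongConvexOn X K fun x => (h x).toReal := by
  refine ⟨hX, fun x hx x' hx' l l' hl hl' hll => ?_⟩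
  obtain rfl : l' = 1 - l := by linarith
  have := hconv x x' l hl (by linarith)
  rw [← hh.coe_toReal hx, ← hh.coe_toReal hx',
    ← hh.coe_toReal (hX hx hx' hl hl' hll)] at this
  norm_cast at this
  rw [norm_sub_rev x x']
  simp only [smul_eq_mul]
  linarith

lemma IsRegularizer.lowerSemicontinuousOn_toReal (hh : IsRegularizer X h) :
    LowerSemicontinuousOn (fun x => (h x).toReal) X := by
  intro x hx c hc
  have hc' : (c : EReal) < h x := by
    rw [← hh.coe_toReal hx]
    exact_mod_cast hc
  have h1 := (hh.lowerSemicontinuous x c hc').filter_mono (nhdsWithin_le_nhds (s := X))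
  filter_upwards [h1, self_mem_nhdsWithin] with x' h1 h2
  rw [← hh.coe_toReal h2] at h1
  exact_mod_cast h1

lemma IsRegularizer.exists_isMaxOn (hh : IsRegularizer X h) (hX : IsCompact X) (hne : X.Nonempty)
    (y : StrongDual ℝ V) : ∃ p ∈ X, IsMaxOn (fun x => y x - (h x).toReal) X p := by
  obtain ⟨p, hp, hmin⟩ := LowerSemicontinuousOn.exists_isMinOn hne hX
    (hh.lowerSemicontinuousOn_toReal.add
      (y.continuous.neg.lowerSemicontinuous.lowerSemicontinuousOn X))
  refine ⟨p, hp, fun x hx => ?_⟩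
  have : (h p).toReal + -y p ≤ (h x).toReal + -y x := hmin hx
  change y x - _ ≤ y p - _
  linarith

lemma IsRegularizer.toReal_conjugate (hh : IsRegularizer X h) {y : StrongDual ℝ V} {p : V}
    (hp : p ∈ X) (hmax : IsMaxOn (fun x => y x - (h x).toReal) X p) :
    (conjugate h y).toReal = y p - (h p).toReal := by
  have : conjugate h y = ((y p - (h p).toReal : ℝ) : EReal) := by
    apply le_antisymm
    · refine iSup_le fun x => ?_
      by_cases hx : x ∈ X
      · rw [← hh.coe_toReal hx]
        exact_mod_cast hmax hx
      · simp [hh.eq_top hx]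
    · refine le_trans ?_ (le_iSup _ p)
      rw [← hh.coe_toReal hp]
      norm_cast
  rw [this, EReal.toReal_coe]

/-- An oscillation bound for the extended-real-valued regularizer bounds the differences of its
(finite) values on `X`. -/
lemma IsRegularizer.toReal_sub_toReal_le (hh : IsRegularizer X h) {Δ : ℝ}
    (hosc : (⨆ x ∈ X, h x) - (⨅ x ∈ X, h x) ≤ (Δ : EReal)) {x x' : V} (hx : x ∈ X)
    (hx' : x' ∈ X) : (h x).toReal - (h x').toReal ≤ Δ := by
  have h1 : h x - h x' ≤ Δ :=
    (EReal.sub_le_sub (le_iSup₂ (f := fun x (_ : x ∈ X) => h x) x hx)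
      (iInf₂_le (f := fun x (_ : x ∈ X) => h x) x' hx')).trans hosc
  rw [← hh.coe_toReal hx, ← hh.coe_toReal hx'] at h1
  exact_mod_cast h1

variable [FiniteDimensional ℝ V]

/-- The gradient of the Legendre--Fenchel transform at `y` is the maximizer of `y - h`. The
transform is differentiable because its first-order expansion at `y`, with slope the maximizer, has a
quadratic error. -/
lemma IsRegularizer.gradConjugate_eq (hh : IsRegularizer X h) (hX : IsCompact X)
    (hXc : Convex ℝ X) (hK : 0 < K) (hconv : IsStronglyConvex K h) {y : StrongDual ℝ V} {p : V}
    (hp : p ∈ X) (hmax : IsMaxOn (fun x => y x - (h x).toReal) X p) :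
    gradConjugate h y = p := by
  have hg := hh.strongConvexOn_toReal hXc hconv
  have hd : HasFDerivAt (fun z => (conjugate h z).toReal)
      (ContinuousLinearMap.apply ℝ ℝ p) y := by
    rw [hasFDerivAt_iff_isLittleO]
    refine Asymptotics.IsBigO.trans_isLittleO (g := fun z => ‖z - y‖ ^ 2) ?_ ?_
    · refine Asymptotics.IsBigO.of_bound (1 / (2 * K)) (Eventually.of_forall fun z => ?_)
      obtain ⟨q, hq, hqmax⟩ := hh.exists_isMaxOn hX ⟨p, hp⟩ z
      rw [hh.toReal_conjugate hp hmax, hh.toReal_conjugate hq hqmax]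
      have h1 := hg.sub_le_of_isMaxOn hK hp hmax hq z
      have h2 : z p - (h p).toReal ≤ z q - (h q).toReal := hqmax hp
      simp only [ContinuousLinearMap.apply_apply, sub_apply, norm_pow,
        abs_norm, Real.norm_eq_abs] at h1 ⊢
      rw [abs_le]
      have : 1 / (2 * K) * ‖z - y‖ ^ 2 = ‖z - y‖ ^ 2 / (2 * K) := by ring
      have : 0 ≤ ‖z - y‖ ^ 2 / (2 * K) := by positivity
      constructor <;> linarith
    · have : Tendsto (fun z : StrongDual ℝ V => z - y) (𝓝 y) (𝓝 0) := by
        simpa using (continuous_id.sub continuous_const).tendsto y (f := fun z => z - y)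
      exact (Asymptotics.isLittleO_norm_pow_id one_lt_two).comp_tendsto this
  refine (SeparatingDual.eq_iff_forall_dual_eq (R := ℝ)).2 fun z => ?_
  rw [apply_gradConjugate, hd.fderiv]
  rfl

lemma IsRegularizer.gradConjugate_mem (hh : IsRegularizer X h) (hX : IsCompact X)
    (hne : X.Nonempty) (hXc : Convex ℝ X) (hK : 0 < K) (hconv : IsStronglyConvex K h)
    (y : StrongDual ℝ V) : gradConjugate h y ∈ X := by
  obtain ⟨p, hp, hmax⟩ := hh.exists_isMaxOn hX hne y
  rwa [hh.gradConjugate_eq hX hXc hK hconv hp hmax]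

lemma IsRegularizer.isMaxOn_gradConjugate (hh : IsRegularizer X h) (hX : IsCompact X)
    (hne : X.Nonempty) (hXc : Convex ℝ X) (hK : 0 < K) (hconv : IsStronglyConvex K h)
    (y : StrongDual ℝ V) : IsMaxOn (fun x => y x - (h x).toReal) X (gradConjugate h y) := by
  obtain ⟨p, hp, hmax⟩ := hh.exists_isMaxOn hX hne y
  rwa [hh.gradConjugate_eq hX hXc hK hconv hp hmax]

lemma IsRegularizer.continuous_gradConjugate (hh : IsRegularizer X h) (hX : IsCompact X)
    (hne : X.Nonempty) (hXc : Convex ℝ X) (hK : 0 < K) (hconv : IsStronglyConvex K h) :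
    Continuous (gradConjugate h) := by
  refine (LipschitzWith.of_dist_le_mul (K := K⁻¹.toNNReal) fun y z => ?_).continuous
  rw [dist_eq_norm, dist_eq_norm, Real.coe_toNNReal _ (inv_nonneg.2 hK.le)]
  exact (hh.strongConvexOn_toReal hXc hconv).norm_sub_le_of_isMaxOn hK
    (hh.gradConjugate_mem hX hne hXc hK hconv y) (hh.isMaxOn_gradConjugate hX hne hXc hK hconv y)
    (hh.gradConjugate_mem hX hne hXc hK hconv z) (hh.isMaxOn_gradConjugate hX hne hXc hK hconv z)

end Regularizer

/-! ### Regret of the FTRL algorithm -/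

section Regret

variable {V : Type*} [NormedAddCommGroup V] [NormedSpace ℝ V] {X : Set V} {g : V → ℝ} {K M : ℝ}

/-- One step of the regret analysis, at a fixed parameter `η`: adding the payoff `R` to the
cumulative payoff `Y` raises the penalized maximum `max_x (Y x - g x / η)`, attained at `p`, by at
most `R p` and an error of order `η`. -/
lemma _root_.StrongConvexOn.apply_add_sub_div_le (hK : 0 < K) (hg : StrongConvexOn X K g) {η : ℝ}
    (hη : 0 < η) {Y R : StrongDual ℝ V} (hR : ‖R‖ ≤ M) {p x : V} (hp : p ∈ X)
    (hmax : IsMaxOn (fun x => (η • Y) x - g x) X p) (hx : x ∈ X) :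
    (Y + R) x - g x / η ≤ Y p - g p / η + R p + M ^ 2 / (2 * K) * η := by
  have h1 := hg.sub_le_of_isMaxOn hK hp hmax hx (η • (Y + R))
  have h2 : η • (Y + R) - η • Y = η • R := by simp
  have h3 : ‖η • R‖ ^ 2 ≤ η ^ 2 * M ^ 2 := by
    rw [norm_smul, mul_pow, Real.norm_eq_abs, sq_abs]
    gcongr
  have h4 : ‖η • R‖ ^ 2 / (2 * K) ≤ η ^ 2 * M ^ 2 / (2 * K) := by gcongr
  rw [h2] at h1
  simp only [smul_apply, smul_eq_mul] at h1
  refine le_of_mul_le_mul_left ?_ hη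
  calc η * ((Y + R) x - g x / η) = η * (Y + R) x - g x := by field_simp
    _ ≤ η * Y p - g p + η * R p + η ^ 2 * M ^ 2 / (2 * K) := h1.trans (by gcongr)
    _ = η * (Y p - g p / η + R p + M ^ 2 / (2 * K) * η) := by field_simp

/-- The regret bound of the FTRL algorithm with nonincreasing parameters. The point played at time
`t` is `p (η (t - 1) • ∑ s < t, R s)`, where `p y` is a maximizer of `y - g`, and `g (p 0)` is the
minimum of `g`. The value of `η 0` is irrelevant to the algorithm, and in the bound its place is
taken by `η 1`. -/
lemma _root_.StrongConvexOn.ftrl_regret_le (hK : 0 < K) (hg : StrongConvexOn X K g)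
    {p : StrongDual ℝ V → V} (hp : ∀ y, p y ∈ X)
    (hmax : ∀ y : StrongDual ℝ V, IsMaxOn (fun x => y x - g x) X (p y))
    {η : ℕ → ℝ} (hη : ∀ t, 1 ≤ t → 0 < η t) (hη' : ∀ t, 1 ≤ t → η (t + 1) ≤ η t)
    {R : ℕ → StrongDual ℝ V} (hR : ∀ t, 1 ≤ t → ‖R t‖ ≤ M) {T : ℕ} (hT : 1 ≤ T) :
    ∀ x ∈ X, (∑ t ∈ Finset.Icc 1 T, R t) x - (g x - g (p 0)) / η T ≤
      ∑ t ∈ Finset.Icc 1 T, R t (p (η (t - 1) • ∑ s ∈ Finset.Ico 1 t, R s)) +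
        M ^ 2 / (2 * K) * (η 1 + ∑ t ∈ Finset.Ico 1 T, η t) := by
  induction T, hT using Nat.le_induction with
  | base =>
    intro x hx
    have h1 := hg.apply_add_sub_div_le hK (hη 1 le_rfl) (Y := 0) (hR 1 le_rfl) (hp 0)
      (by simpa only [smul_zero] using hmax 0) hx
    simp only [zero_add, zero_apply] at h1
    simp only [Finset.Icc_self, Finset.sum_singleton, Finset.Ico_self, Finset.sum_empty, smul_zero,
      add_zero, sub_div]
    linarith
  | succ T hT ih =>
    intro x hx
    set Y := ∑ t ∈ Finset.Icc 1 T, R t with hY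
    have hY' : ∑ s ∈ Finset.Ico 1 (T + 1), R s = Y := by
      rw [hY, Finset.Ico_add_one_right_eq_Icc]
    have h1 := hg.apply_add_sub_div_le hK (hη T hT) (hR (T + 1) (by lia)) (hp _) (hmax (η T • Y)) hx
    have h2 := ih _ (hp (η T • Y))
    have h3 : (g x - g (p 0)) / η T ≤ (g x - g (p 0)) / η (T + 1) := by
      have h0 : 0 ≤ g x - g (p 0) := by
        have : (0 : StrongDual ℝ V) x - g x ≤ (0 : StrongDual ℝ V) (p 0) - g (p 0) := hmax 0 hx
        simp only [zero_apply] at this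
        linarith
      exact div_le_div_of_nonneg_left h0 (hη _ (by lia)) (hη' T hT)
    rw [Finset.sum_Icc_succ_top (by lia), Finset.sum_Icc_succ_top (by lia),
      Nat.add_sub_cancel, hY',
      Finset.sum_Ico_succ_top hT]
    simp only [sub_div] at h2 h3 ⊢
    linarith

/-- The sum of the `1 / √t`, with the first term counted twice and the last one left out, is below
`2 √T`. The correction `1 / √T` makes the induction go through. -/
lemma one_add_sum_inv_sqrt_le {T : ℕ} (hT : 1 ≤ T) :
    1 + ∑ t ∈ Finset.Ico 1 T, 1 / √(t : ℝ) ≤ 2 * √(T : ℝ) - 1 / √(T : ℝ) := by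
  induction T, hT using Nat.le_induction with
  | base => norm_num
  | succ T hT ih =>
    rw [Finset.sum_Ico_succ_top hT]
    have hT0 : (0 : ℝ) < T := by exact_mod_cast hT
    have hu : √(T : ℝ) ^ 2 = T := Real.sq_sqrt hT0.le
    have hv : √((T + 1 : ℕ) : ℝ) ^ 2 = T + 1 := by
      rw [Real.sq_sqrt (by positivity)]
      push_cast
      rfl
    have hu0 : 0 < √(T : ℝ) := Real.sqrt_pos.2 hT0
    have hv0 : 0 < √((T + 1 : ℕ) : ℝ) := Real.sqrt_pos.2 (by positivity)
    generalize √(T : ℝ) = u at *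
    generalize √((T + 1 : ℕ) : ℝ) = v at *
    have key : 1 / v ≤ 2 * v - 2 * u := by
      rw [div_le_iff₀ hv0]
      nlinarith [sq_nonneg (v - u)]
    linarith

/-- The regret bound for the parameters `η t = √(Δ K / (M² t))`: the penalty `Δ / η T` and the
accumulated errors each contribute `M √(Δ / K) √T`. -/
lemma regret_bound_le {Δ : ℝ} (hΔ : 0 < Δ) (hM : 0 < M) (hK : 0 < K) {T : ℕ} (hT : 1 ≤ T) :
    Δ / √(Δ * K / (M ^ 2 * (T : ℝ))) + M ^ 2 / (2 * K) *
      (√(Δ * K / (M ^ 2 * ((1 : ℕ) : ℝ))) +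
        ∑ t ∈ Finset.Ico 1 T, √(Δ * K / (M ^ 2 * (t : ℝ)))) ≤ 2 * M * √(Δ / K) * √(T : ℝ) := by
  have hη : ∀ t : ℕ, √(Δ * K / (M ^ 2 * (t : ℝ))) = √Δ * √K / M * (1 / √(t : ℝ)) := fun t => by
    rw [Real.sqrt_div (by positivity), Real.sqrt_mul hΔ.le, Real.sqrt_mul (by positivity),
      Real.sqrt_sq hM.le]
    ring
  have hT0 : 0 < √(T : ℝ) := Real.sqrt_pos.2 (by exact_mod_cast hT)
  have hsum : 1 + ∑ t ∈ Finset.Ico 1 T, 1 / √(t : ℝ) ≤ 2 * √(T : ℝ) :=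
    (one_add_sum_inv_sqrt_le hT).trans (sub_le_self _ (by positivity))
  simp only [hη]
  rw [Nat.cast_one, Real.sqrt_one, div_one, ← Finset.mul_sum, ← mul_add, Real.sqrt_div hΔ.le]
  have hu : √Δ ^ 2 = Δ := Real.sq_sqrt hΔ.le
  have hk : √K ^ 2 = K := Real.sq_sqrt hK.le
  have hu0 : 0 < √Δ := Real.sqrt_pos.2 hΔ
  have hk0 : 0 < √K := Real.sqrt_pos.2 hK
  generalize √Δ = u at *
  generalize √K = k at *
  subst hu hk
  calc _ ≤ u ^ 2 / (u * k / M * (1 / √(T : ℝ))) +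
        M ^ 2 / (2 * k ^ 2) * (u * k / M * (2 * √(T : ℝ))) := by gcongr
    _ = _ := by
      field_simp
      ring

end Regret

/-! ### Support functions -/

section Support

variable {V : Type*} [NormedAddCommGroup V] {X : Set V}

lemma norm_le_setNorm (hX : IsCompact X) {x : V} (hx : x ∈ X) : ‖x‖ ≤ setNorm X :=
  le_csSup (hX.image continuous_norm).bddAbove ⟨x, hx, rfl⟩

lemma setNorm_nonneg (X : Set V) : 0 ≤ setNorm X :=
  Real.sSup_nonneg (by rintro _ ⟨x, -, rfl⟩; exact norm_nonneg x)

variable [NormedSpace ℝ V]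

lemma apply_le_supportFun (hX : IsCompact X) (y : StrongDual ℝ V) {x : V} (hx : x ∈ X) :
    y x ≤ supportFun X y :=
  le_csSup (hX.image y.continuous).bddAbove ⟨x, hx, rfl⟩

lemma supportFun_le (hne : X.Nonempty) {y : StrongDual ℝ V} {c : ℝ} (hc : ∀ x ∈ X, y x ≤ c) :
    supportFun X y ≤ c :=
  csSup_le (hne.image _) (by rintro _ ⟨x, hx, rfl⟩; exact hc x hx)

lemma abs_apply_le (hX : IsCompact X) (y : StrongDual ℝ V) {x : V} (hx : x ∈ X) :
    |y x| ≤ ‖y‖ * setNorm X :=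
  (y.le_opNorm x).trans (by gcongr; exact norm_le_setNorm hX hx)

lemma abs_supportFun_le (hX : IsCompact X) (hne : X.Nonempty) (y : StrongDual ℝ V) :
    |supportFun X y| ≤ ‖y‖ * setNorm X := by
  obtain ⟨x, hx⟩ := hne
  exact abs_le.2 ⟨(abs_le.1 (abs_apply_le hX y hx)).1.trans (apply_le_supportFun hX y hx),
    supportFun_le ⟨x, hx⟩ fun x hx => (abs_le.1 (abs_apply_le hX y hx)).2⟩

lemma continuous_supportFun (hX : IsCompact X) (hne : X.Nonempty) :
    Continuous (supportFun X) := by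
  refine (LipschitzWith.of_le_add_mul (setNorm X).toNNReal fun y z => ?_).continuous
  refine supportFun_le hne fun x hx => ?_
  have h1 := apply_le_supportFun hX z hx
  have h2 := (abs_le.1 (abs_apply_le hX (y - z) hx)).2
  rw [sub_apply] at h2
  rw [dist_eq_norm, Real.coe_toNNReal _ (setNorm_nonneg X)]
  linarith

end Support

/-! ### Supermartingale differences from randomized actions, and the Azuma--Hoeffding inequality -/

section Draw

variable {Ω : Type*} {m mΩ : MeasurableSpace Ω} {μ : Measure Ω} [IsProbabilityMeasure μ] {d : ℕ}

lemma sum_indicator_preimage_mul (i : Ω → Fin d) (f : Fin d → Ω → ℝ) (ω : Ω) :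
    ∑ j, f j ω * (i ⁻¹' {j}).indicator (fun _ => (1 : ℝ)) ω = f (i ω) ω := by
  rw [Finset.sum_eq_single (i ω)]
  · rw [Set.indicator_of_mem (by simp), mul_one]
  · intro j _ hj
    rw [Set.indicator_of_notMem (by simpa using hj.symm), mul_zero]
  · simp

lemma measurable_apply_draw {i : Ω → Fin d} (hi : Measurable i) {f : Fin d → Ω → ℝ}
    (hf : ∀ j, Measurable (f j)) : Measurable fun ω => f (i ω) ω :=
  (measurable_from_prod_countable_right (f := fun q : Fin d × Ω => f q.1 q.2) hf).comp
    (hi.prodMk measurable_id)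

/-- If, conditionally on `m`, the pure action `i` is drawn from the mixed action `a`, then
`m`-measurable payoffs may be averaged over the draw. -/
lemma integral_apply_draw (hm : m ≤ mΩ) {i : Ω → Fin d} (hi : Measurable i)
    {a : Ω → Fin d → ℝ}
    (hlaw : ∀ j, μ[(i ⁻¹' {j}).indicator (fun _ => (1 : ℝ)) | m] =ᵐ[μ] fun ω => a ω j)
    {f : Fin d → Ω → ℝ} (hf : ∀ j, Measurable[m] (f j)) {c : ℝ} (hc : ∀ j ω, |f j ω| ≤ c) :
    ∫ ω, f (i ω) ω ∂μ = ∫ ω, ∑ j, a ω j * f j ω ∂μ := by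
  have hind : ∀ j, Integrable ((i ⁻¹' {j}).indicator fun _ => (1 : ℝ)) μ := fun j =>
    (integrable_const _).indicator (hi (measurableSet_singleton j))
  have hpull : ∀ j, μ[f j * (i ⁻¹' {j}).indicator (fun _ => (1 : ℝ)) | m] =ᵐ[μ]
      fun ω => a ω j * f j ω := fun j => by
    filter_upwards [condExp_stronglyMeasurable_mul_of_bound hm (hf j).stronglyMeasurable (hind j) c
      (Eventually.of_forall (hc j)), hlaw j] with ω h1 h2
    rw [h1, Pi.mul_apply, h2, mul_comm]
  have hint : ∀ j, Integrable (f j * (i ⁻¹' {j}).indicator fun _ => (1 : ℝ)) μ := fun j =>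
    (hind j).bdd_mul ((hf j).mono hm le_rfl).aestronglyMeasurable (Eventually.of_forall (hc j))
  have hint' : ∀ j, Integrable (fun ω => a ω j * f j ω) μ := fun j =>
    integrable_condExp.congr (hpull j)
  simp only [← sum_indicator_preimage_mul i f]
  rw [integral_finsetSum _ (f := fun j ω => f j ω * (i ⁻¹' {j}).indicator (fun _ => (1 : ℝ)) ω)
    fun j _ => hint j, integral_finsetSum _ fun j _ => hint' j]
  refine Finset.sum_congr rfl fun j _ => ?_
  rw [← integral_congr_ae (hpull j), integral_condExp hm]
  rfl

end Draw

/-- Hoeffding's lemma for a finitely supported law of nonpositive mean and a nonnegative parameter: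
by convexity `exp` lies on `[-c l, c l]` below its chord, and the average of the chord is at most
`cosh (c l)`. -/
lemma sum_mul_exp_le {ι : Type*} [Fintype ι] {p : ι → ℝ} (hp : p ∈ stdSimplex ℝ ι) {w : ι → ℝ}
    {c : ℝ} (hc : 0 < c) (hw : ∀ j, |w j| ≤ c) (hmean : ∑ j, p j * w j ≤ 0) {l : ℝ} (hl : 0 ≤ l) :
    ∑ j, p j * Real.exp (l * w j) ≤ Real.exp (l ^ 2 * c ^ 2 / 2) := by
  have hchord : ∀ j, Real.exp (l * w j) ≤ Real.cosh (l * c) + w j / c * Real.sinh (l * c) := by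
    intro j
    obtain ⟨h1, h2⟩ := abs_le.1 (hw j)
    have ha : 0 ≤ (c + w j) / (2 * c) := div_nonneg (by linarith) (by linarith)
    have hb : 0 ≤ (c - w j) / (2 * c) := div_nonneg (by linarith) (by linarith)
    have h3 := convexOn_exp.2 (Set.mem_univ (l * c)) (Set.mem_univ (-(l * c))) ha hb
      (by field_simp; ring)
    have h4 : (c + w j) / (2 * c) * (l * c) + (c - w j) / (2 * c) * -(l * c) = l * w j := by
      field_simp
      ring
    simp only [smul_eq_mul] at h3
    rw [h4] at h3
    refine h3.trans_eq ?_
    rw [Real.cosh_eq, Real.sinh_eq]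
    field_simp
    ring
  calc ∑ j, p j * Real.exp (l * w j)
      ≤ ∑ j, p j * (Real.cosh (l * c) + w j / c * Real.sinh (l * c)) :=
        Finset.sum_le_sum fun j _ => mul_le_mul_of_nonneg_left (hchord j) (hp.1 j)
    _ = (∑ j, p j) * Real.cosh (l * c) + (∑ j, p j * w j) * (Real.sinh (l * c) / c) := by
        rw [Finset.sum_mul, Finset.sum_mul, ← Finset.sum_add_distrib]
        exact Finset.sum_congr rfl fun j _ => by ring
    _ ≤ 1 * Real.cosh (l * c) + 0 := by
        rw [hp.2]
        have := mul_nonpos_of_nonpos_of_nonneg hmean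
          (div_nonneg (Real.sinh_nonneg_iff.2 (mul_nonneg hl hc.le)) hc.le)
        linarith
    _ ≤ Real.exp (l ^ 2 * c ^ 2 / 2) := by
        rw [one_mul, add_zero, ← mul_pow]
        exact Real.cosh_le_exp_half_sq _

/-- A sequence of randomized decisions with nonpositive conditional mean. At each time `t ≥ 1`, given
the information `m t`, a pure action `i t` is drawn from the mixed action `a t`; the payoff of `j` at
time `t` would be `w t j`, which is known at that time, bounded by `c`, and has nonpositive average
with respect to `a t`. Then the realized payoffs `w t (i t)` are supermartingale differences. -/
structure IsSupermartingaleDraw {Ω : Type*} [MeasurableSpace Ω] {d : ℕ} (μ : Measure Ω)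
    (m : ℕ → MeasurableSpace Ω) (a : ℕ → Ω → Fin d → ℝ) (i : ℕ → Ω → Fin d)
    (w : ℕ → Fin d → Ω → ℝ) (c : ℝ) : Prop where
  le : ∀ t, 1 ≤ t → m t ≤ ‹MeasurableSpace Ω›
  measurable_draw : ∀ t, 1 ≤ t → Measurable (i t)
  law : ∀ t, 1 ≤ t → ∀ j,
    μ[(i t ⁻¹' {j}).indicator (fun _ => (1 : ℝ)) | m t] =ᵐ[μ] fun ω => a t ω j
  mem_simplex : ∀ t, 1 ≤ t → ∀ ω, a t ω ∈ stdSimplex ℝ (Fin d)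
  measurable : ∀ t, 1 ≤ t → ∀ j, Measurable[m t] (w t j)
  measurable_past : ∀ s t, 1 ≤ s → s < t → Measurable[m t] fun ω => w s (i s ω) ω
  abs_payoff_le : ∀ t, 1 ≤ t → ∀ j ω, |w t j ω| ≤ c
  mean_nonpos : ∀ t, 1 ≤ t → ∀ ω, ∑ j, a t ω j * w t j ω ≤ 0

namespace IsSupermartingaleDraw

variable {Ω : Type*} [mΩ : MeasurableSpace Ω] {d : ℕ} {μ : Measure Ω}
  {m : ℕ → MeasurableSpace Ω} {a : ℕ → Ω → Fin d → ℝ} {i : ℕ → Ω → Fin d}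
  {w : ℕ → Fin d → Ω → ℝ} {c : ℝ}

lemma measurable_sum (H : IsSupermartingaleDraw μ m a i w c) (T : ℕ) :
    Measurable fun ω => ∑ t ∈ Finset.Icc 1 T, w t (i t ω) ω :=
  Finset.measurable_sum _ fun t ht =>
    have ht := (Finset.mem_Icc.1 ht).1
    measurable_apply_draw (H.measurable_draw t ht) fun j =>
      (H.measurable t ht j).mono (H.le t ht) le_rfl

lemma abs_sum_le (H : IsSupermartingaleDraw μ m a i w c) (T : ℕ) (ω : Ω) :
    |∑ t ∈ Finset.Icc 1 T, w t (i t ω) ω| ≤ T * c := by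
  refine (Finset.abs_sum_le_sum_abs _ _).trans ((Finset.sum_le_card_nsmul _ _ c fun t ht =>
    H.abs_payoff_le t (Finset.mem_Icc.1 ht).1 _ ω).trans_eq ?_)
  simp

lemma exp_sum_le (H : IsSupermartingaleDraw μ m a i w c) {l : ℝ} (hl : 0 ≤ l) (T : ℕ) (ω : Ω) :
    Real.exp (l * ∑ t ∈ Finset.Icc 1 T, w t (i t ω) ω) ≤ Real.exp (l * (T * c)) := by
  gcongr
  exact (abs_le.1 (H.abs_sum_le T ω)).2

variable [IsProbabilityMeasure μ]

lemma integrable_sum (H : IsSupermartingaleDraw μ m a i w c) (T : ℕ) :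
    Integrable (fun ω => ∑ t ∈ Finset.Icc 1 T, w t (i t ω) ω) μ :=
  .of_bound (H.measurable_sum T).aestronglyMeasurable (T * c) (Eventually.of_forall (H.abs_sum_le T))

lemma integral_sum_nonpos (H : IsSupermartingaleDraw μ m a i w c) (T : ℕ) :
    ∫ ω, ∑ t ∈ Finset.Icc 1 T, w t (i t ω) ω ∂μ ≤ 0 := by
  rw [integral_finsetSum]
  · refine Finset.sum_nonpos fun t ht => ?_
    have ht := (Finset.mem_Icc.1 ht).1
    rw [integral_apply_draw (H.le t ht) (H.measurable_draw t ht) (H.law t ht) (H.measurable t ht)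
      (H.abs_payoff_le t ht)]
    exact integral_nonpos (H.mean_nonpos t ht)
  · intro t ht
    have ht := (Finset.mem_Icc.1 ht).1
    exact .of_bound (measurable_apply_draw (H.measurable_draw t ht) fun j =>
      (H.measurable t ht j).mono (H.le t ht) le_rfl).aestronglyMeasurable c
      (Eventually.of_forall fun ω => H.abs_payoff_le t ht _ ω)

lemma integrable_exp_sum (H : IsSupermartingaleDraw μ m a i w c) {l : ℝ} (hl : 0 ≤ l) (T : ℕ) :
    Integrable (fun ω => Real.exp (l * ∑ t ∈ Finset.Icc 1 T, w t (i t ω) ω)) μ :=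
  .of_bound ((H.measurable_sum T).const_mul l).exp.aestronglyMeasurable (Real.exp (l * (T * c)))
    (Eventually.of_forall fun ω => by
      rw [Real.norm_eq_abs, Real.abs_exp]
      exact H.exp_sum_le hl T ω)

/-- The exponential moment bound of the Azuma--Hoeffding inequality. In the induction step the last
payoff is averaged over its draw, and Hoeffding's lemma is applied to the conditional law. -/
lemma integral_exp_sum_le (H : IsSupermartingaleDraw μ m a i w c) (hc : 0 < c) {l : ℝ} (hl : 0 ≤ l)
    (T : ℕ) : ∫ ω, Real.exp (l * ∑ t ∈ Finset.Icc 1 T, w t (i t ω) ω) ∂μ ≤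
      Real.exp (T * (l ^ 2 * c ^ 2 / 2)) := by
  induction T with
  | zero => simp
  | succ T ih =>
    have hT : 1 ≤ T + 1 := by lia
    set S : Ω → ℝ := fun ω => ∑ t ∈ Finset.Icc 1 T, w t (i t ω) ω
    have hSm : Measurable[m (T + 1)] S := Finset.measurable_sum _ fun t ht =>
      H.measurable_past t (T + 1) (Finset.mem_Icc.1 ht).1 (by have := (Finset.mem_Icc.1 ht).2; lia)
    set f : Fin d → Ω → ℝ := fun j ω => Real.exp (l * S ω) * Real.exp (l * w (T + 1) j ω) with hf
    have hfm : ∀ j, Measurable[m (T + 1)] (f j) := fun j =>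
      (hSm.const_mul l).exp.mul ((H.measurable (T + 1) hT j).const_mul l).exp
    have hfb : ∀ j ω, |f j ω| ≤ Real.exp (l * (T * c)) * Real.exp (l * c) := fun j ω => by
      simp only [hf]
      rw [abs_of_nonneg (by positivity)]
      have h1 := H.exp_sum_le hl T ω
      have h2 := (abs_le.1 (H.abs_payoff_le (T + 1) hT j ω)).2
      gcongr
    have h1 : ∀ ω, Real.exp (l * ∑ t ∈ Finset.Icc 1 (T + 1), w t (i t ω) ω) = f (i (T + 1) ω) ω :=
      fun ω => by rw [Finset.sum_Icc_succ_top hT, mul_add, Real.exp_add]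
    have h2 : ∀ ω, ∑ j, a (T + 1) ω j * f j ω ≤
        Real.exp (l * S ω) * Real.exp (l ^ 2 * c ^ 2 / 2) := fun ω => by
      have := sum_mul_exp_le (H.mem_simplex (T + 1) hT ω) hc (fun j => H.abs_payoff_le (T + 1) hT j ω)
        (H.mean_nonpos (T + 1) hT ω) hl
      calc _ = Real.exp (l * S ω) * ∑ j, a (T + 1) ω j * Real.exp (l * w (T + 1) j ω) := by
            rw [Finset.mul_sum]
            exact Finset.sum_congr rfl fun j _ => by simp only [hf]; ring
        _ ≤ _ := by gcongr
    simp only [h1]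
    rw [integral_apply_draw (H.le _ hT) (H.measurable_draw _ hT) (H.law _ hT) hfm hfb]
    calc ∫ ω, ∑ j, a (T + 1) ω j * f j ω ∂μ
        ≤ ∫ ω, Real.exp (l * S ω) * Real.exp (l ^ 2 * c ^ 2 / 2) ∂μ := by
          refine integral_mono_of_nonneg (Eventually.of_forall fun ω => ?_)
            ((H.integrable_exp_sum hl T).mul_const _) (Eventually.of_forall h2)
          exact Finset.sum_nonneg fun j _ =>
            mul_nonneg ((H.mem_simplex (T + 1) hT ω).1 j) (by simp only [hf]; positivity)
      _ ≤ Real.exp (T * (l ^ 2 * c ^ 2 / 2)) * Real.exp (l ^ 2 * c ^ 2 / 2) := by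
          rw [integral_mul_const]
          gcongr
      _ = _ := by
          rw [← Real.exp_add]
          push_cast
          ring_nf

/-- The Azuma--Hoeffding inequality, in terms of the confidence level. -/
lemma measureReal_lt_sum_le (H : IsSupermartingaleDraw μ m a i w c) (hc : 0 ≤ c) {δ : ℝ}
    (hδ : 0 < δ) (hδ' : δ < 1) {T : ℕ} (hT : 1 ≤ T) :
    μ.real {ω | c * √T * √(2 * Real.log (1 / δ)) < ∑ t ∈ Finset.Icc 1 T, w t (i t ω) ω} ≤ δ := by
  rcases hc.eq_or_lt with rfl | hc
  · -- If `c = 0` all payoffs vanish, so that the event is empty.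
    have : ∀ ω, ¬ 0 < ∑ t ∈ Finset.Icc 1 T, w t (i t ω) ω := fun ω =>
      not_lt.2 (by simpa using (abs_le.1 (H.abs_sum_le T ω)).2)
    simp [this, hδ.le]
  · have hT0 : (0 : ℝ) < T := by exact_mod_cast hT
    have hlog : 0 < Real.log (1 / δ) := Real.log_pos ((one_lt_div hδ).2 hδ')
    set L := √(2 * Real.log (1 / δ))
    have hL2 : L ^ 2 = 2 * Real.log (1 / δ) := Real.sq_sqrt (by positivity)
    have hr2 : √(T : ℝ) ^ 2 = T := Real.sq_sqrt hT0.le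
    have hr0 : 0 < √(T : ℝ) := Real.sqrt_pos.2 hT0
    -- The minimizer over `l` of the exponent `-l ε + T l² c² / 2`, where `ε = c √T L`.
    set l := L / (c * √(T : ℝ)) with hl
    have hl0 : 0 ≤ l := by positivity
    calc μ.real {ω | c * √T * L < ∑ t ∈ Finset.Icc 1 T, w t (i t ω) ω}
        ≤ μ.real {ω | c * √T * L ≤ ∑ t ∈ Finset.Icc 1 T, w t (i t ω) ω} :=
          measureReal_mono fun ω hω => by
            rw [Set.mem_ofPred_eq] at hω ⊢
            exact hω.le
      _ ≤ Real.exp (-l * (c * √T * L)) *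
            ∫ ω, Real.exp (l * ∑ t ∈ Finset.Icc 1 T, w t (i t ω) ω) ∂μ :=
          ProbabilityTheory.measure_ge_le_exp_mul_mgf _ hl0 (H.integrable_exp_sum hl0 T)
      _ ≤ Real.exp (-l * (c * √T * L)) * Real.exp (T * (l ^ 2 * c ^ 2 / 2)) := by
          gcongr
          exact H.integral_exp_sum_le hc hl0 T
      _ = Real.exp (-Real.log (1 / δ)) := by
          rw [← Real.exp_add]
          congr 1
          have h1 : l * (c * √T * L) = L ^ 2 := by
            rw [hl]
            field_simp
          have h2 : T * (l ^ 2 * c ^ 2 / 2) = L ^ 2 / 2 := by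
            nth_rewrite 1 [hl, ← hr2]
            field_simp
          rw [neg_mul, h1, h2, hL2]
          ring
      _ = δ := by rw [one_div, Real.log_inv, neg_neg, Real.exp_log hδ]

end IsSupermartingaleDraw

/-! ### The game -/

section Game

variable {V : Type*} [NormedAddCommGroup V] [NormedSpace ℝ V] {B : Type*} {d : ℕ}
  {r : Fin d → B → StrongDual ℝ V}

lemma mixedPayoff_apply (a : Fin d → ℝ) (b : B) (x : V) :
    mixedPayoff r a b x = ∑ j, a j * r j b x := by
  simp [mixedPayoff, sum_apply]

lemma norm_payoff_le {M : ℝ} (hbound : ∀ a ∈ stdSimplex ℝ (Fin d), ∀ b : B, ‖mixedPayoff r a b‖ ≤ M)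
    (j : Fin d) (b : B) : ‖r j b‖ ≤ M := by
  simpa [mixedPayoff, Pi.single_apply] using hbound _ (single_mem_stdSimplex ℝ j) b

lemma IsGenerator.nonempty {X : Set V} {S : Set (StrongDual ℝ V)}
    (hX : IsGenerator X (polarCone S)) : X.Nonempty := by
  have h0 : (0 : V) ∈ polarCone S := fun y _ => by simp
  rw [← hX.cone_eq] at h0
  obtain ⟨_, _, x, hx, _⟩ := h0
  exact ⟨x, hx⟩

lemma IsGenerator.subset {X D : Set V} (hX : IsGenerator X D) : X ⊆ D := fun x hx => by
  rw [← hX.cone_eq]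
  exact ⟨1, zero_le_one, x, hx, (one_smul ℝ x).symm⟩

section History

variable [MeasurableSpace B] {Ω : Type*} {a : ℕ → Ω → Fin d → ℝ} {b : ℕ → Ω → B}
  {i : ℕ → Ω → Fin d}

lemma measurable_env_history {s t : ℕ} (hs : 1 ≤ s) (hst : s ≤ t) :
    Measurable[history a b i t] (b s) :=
  measurable_iff_comap_le.2 <| le_sup_right.trans <|
    (le_iSup₂ (f := fun s (_ : s ∈ Finset.Icc 1 t) => MeasurableSpace.comap (a s) inferInstance ⊔
      MeasurableSpace.comap (b s) inferInstance) s (Finset.mem_Icc.2 ⟨hs, hst⟩)).trans le_sup_left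

lemma measurable_pure_history {s t : ℕ} (hs : 1 ≤ s) (hst : s < t) :
    Measurable[history a b i t] (i s) :=
  measurable_iff_comap_le.2 <|
    (le_iSup₂ (f := fun s (_ : s ∈ Finset.Ico 1 t) => MeasurableSpace.comap (i s) inferInstance)
      s (Finset.mem_Ico.2 ⟨hs, hst⟩)).trans le_sup_right

lemma measurable_payoff {mΩ : MeasurableSpace Ω} (hr : ∀ j, Measurable (r j)) {t : ℕ}
    (hi : Measurable (i t)) (hb : Measurable (b t)) : Measurable (payoff r i b t) :=
  (measurable_from_prod_countable_right (f := fun q : Fin d × B => r q.1 q.2) hr).comp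
    (hi.prodMk hb)

variable [MeasurableSpace Ω]

lemma history_le {t : ℕ} (ha : ∀ s, 1 ≤ s → Measurable (a s)) (hb : ∀ s, 1 ≤ s → Measurable (b s))
    (hi : ∀ s, 1 ≤ s → Measurable (i s)) : history a b i t ≤ ‹MeasurableSpace Ω› :=
  sup_le
    (iSup₂_le fun s hs => sup_le (ha s (Finset.mem_Icc.1 hs).1).comap_le
      (hb s (Finset.mem_Icc.1 hs).1).comap_le)
    (iSup₂_le fun s hs => (hi s (Finset.mem_Ico.1 hs).1).comap_le)

end History

variable [FiniteDimensional ℝ V] {Ω : Type*} {h : V → EReal} {b : ℕ → Ω → B} {i : ℕ → Ω → Fin d}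

/-- The deterministic part of the argument: whatever the realized payoffs, the support function of
the average payoff exceeds the average of `⟨r_t, x_t⟩` by at most the average regret. -/
lemma supportFun_avgPayoff_le {X : Set V} (hXc : Convex ℝ X) (hX : IsCompact X) (hne : X.Nonempty)
    (hh : IsRegularizer X h) {Δ K M : ℝ} (hΔ : 0 < Δ) (hM : 0 < M) (hK : 0 < K)
    (hosc : (⨆ x ∈ X, h x) - (⨅ x ∈ X, h x) ≤ (Δ : EReal)) (hconv : IsStronglyConvex K h)
    (hbound : ∀ j b, ‖r j b‖ ≤ M) {T : ℕ} (hT : 1 ≤ T) (ω : Ω) :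
    supportFun X (avgPayoff r i b T ω) ≤ (T : ℝ)⁻¹ *
      (∑ t ∈ Finset.Icc 1 T, payoff r i b t ω
        (ftrlPoint h (fun t => √(Δ * K / (M ^ 2 * (t : ℝ)))) r i b t ω) +
        2 * M * √(Δ / K) * √(T : ℝ)) := by
  have hT0 : (0 : ℝ) < T := by exact_mod_cast hT
  have hη : ∀ t : ℕ, 1 ≤ t → 0 < √(Δ * K / (M ^ 2 * (t : ℝ))) := fun t ht => by
    have : (0 : ℝ) < t := by exact_mod_cast ht
    positivity
  refine supportFun_le hne fun x hx => ?_
  have h1 := (hh.strongConvexOn_toReal hXc hconv).ftrl_regret_le hK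
    (hh.gradConjugate_mem hX hne hXc hK hconv) (hh.isMaxOn_gradConjugate hX hne hXc hK hconv) hη
    (fun t ht => by
      have : (0 : ℝ) < t := by exact_mod_cast ht
      gcongr
      simp)
    (R := fun t => payoff r i b t ω) (fun t _ => hbound _ _) hT x hx
  have h2 := regret_bound_le hΔ hM hK hT
  have h3 : ((h x).toReal - (h (gradConjugate h 0)).toReal) / √(Δ * K / (M ^ 2 * (T : ℝ))) ≤
      Δ / √(Δ * K / (M ^ 2 * (T : ℝ))) := by
    gcongr
    exact hh.toReal_sub_toReal_le hosc hx (hh.gradConjugate_mem hX hne hXc hK hconv 0)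
  rw [avgPayoff, smul_apply, smul_eq_mul]
  refine mul_le_mul_of_nonneg_left ?_ (inv_nonneg.2 hT0.le)
  simp only [ftrlPoint]
  linarith

variable [MeasurableSpace B] [MeasurableSpace Ω] {μ : Measure Ω} {η : ℕ → ℝ} {α : V → Fin d → ℝ}
  {a : ℕ → Ω → Fin d → ℝ}

instance secondCountableTopology_strongDual : SecondCountableTopology (StrongDual ℝ V) :=
  have := FiniteDimensional.proper ℝ (StrongDual ℝ V)
  inferInstance

lemma IsFTRLPlay.measurable_avgPayoff (hplay : IsFTRLPlay μ r h η α a b i)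
    (hr : ∀ j, Measurable (r j)) (T : ℕ) : Measurable (avgPayoff r i b T) :=
  (Finset.measurable_sum _ fun t ht =>
    measurable_payoff hr (hplay.measurable_pure t (Finset.mem_Icc.1 ht).1)
      (hplay.measurable_env t (Finset.mem_Icc.1 ht).1)).const_smul ((T : ℝ)⁻¹)

/-- The quantities `⟨r_t, x_t⟩` are supermartingale differences: the oracle makes their conditional
expectation `⟨r(a_t, b_t), x_t⟩` nonpositive, as `x_t` belongs to the generator and therefore to the
polar cone. -/
lemma IsFTRLPlay.isSupermartingaleDraw (hplay : IsFTRLPlay μ r h η α a b i)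
    (hr : ∀ j, Measurable (r j)) {C : ProperCone ℝ (StrongDual ℝ V)} (hα : IsOracle r C α)
    {X : Set V} (hX : IsGenerator X (polarCone (C : Set (StrongDual ℝ V))))
    (hh : IsRegularizer X h) {K M : ℝ} (hK : 0 < K) (hconv : IsStronglyConvex K h)
    (hbound : ∀ j b, ‖r j b‖ ≤ M) :
    IsSupermartingaleDraw μ (history a b i) a i
      (fun t j ω => r j (b t ω) (ftrlPoint h η r i b t ω)) (M * setNorm X) := by
  have hmem : ∀ t ω, ftrlPoint h η r i b t ω ∈ X := fun t ω =>
    hh.gradConjugate_mem hX.isCompact hX.nonempty hX.convex hK hconv _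
  have hcont := hh.continuous_gradConjugate hX.isCompact hX.nonempty hX.convex hK hconv
  -- Evaluation of a random linear form at `x_t`, for any σ-algebra that knows the past payoffs.
  have hmeas : ∀ (m : MeasurableSpace Ω) (t : ℕ) (y : Ω → StrongDual ℝ V), Measurable[m] y →
      (∀ s, 1 ≤ s → s < t → Measurable[m] (payoff r i b s)) →
      Measurable[m] fun ω => y ω (ftrlPoint h η r i b t ω) := fun m t y hy hpast =>
    Continuous.measurable2 (c := fun (y z : StrongDual ℝ V) => y (gradConjugate h z))
      (continuous_fst.clm_apply (hcont.comp continuous_snd)) hy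
      ((Finset.measurable_sum _ fun s hs =>
        hpast s (Finset.mem_Ico.1 hs).1 (Finset.mem_Ico.1 hs).2).const_smul (η (t - 1)))
  have hpay : ∀ s t, 1 ≤ s → s < t → Measurable[history a b i t] (payoff r i b s) :=
    fun s t hs hst => measurable_payoff hr (measurable_pure_history hs hst)
      (measurable_env_history hs hst.le)
  refine
    { le := fun t _ =>
        history_le hplay.measurable_mixed hplay.measurable_env hplay.measurable_pure
      measurable_draw := hplay.measurable_pure
      law := hplay.pure_law
      mem_simplex := fun t ht ω => ?_
      measurable := fun t ht j => ?_
      measurable_past := fun s t hs hst => ?_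
      abs_payoff_le := fun t _ j ω => ?_
      mean_nonpos := fun t ht ω => ?_ }
  · rw [hplay.mixed_eq t ht ω]
    exact (hα _ (hX.subset (hmem t ω))).1
  · exact hmeas _ t _ ((hr j).comp (measurable_env_history ht le_rfl)) fun s hs hst => hpay s t hs hst
  · exact hmeas _ s _ (hpay s t hs hst) fun s' hs' hss' => hpay s' t hs' (hss'.trans hst)
  · refine (abs_apply_le hX.isCompact _ (hmem t ω)).trans ?_
    gcongr
    · exact setNorm_nonneg X
    · exact hbound j _
  · rw [hplay.mixed_eq t ht ω, ← mixedPayoff_apply]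
    exact (hα _ (hX.subset (hmem t ω))).2 _

end Game

/-- The high-probability bound at confidence level `1 - 1 / T²` tends to `0`. -/
lemma tendsto_high_probability_bound (M A N : ℝ) :
    Tendsto (fun T : ℕ => M / √(T : ℝ) * (A + N * √(2 * Real.log (1 / (1 / (T : ℝ) ^ 2))))) atTop
      (𝓝 0) := by
  have h1 : Tendsto (fun T : ℕ => M * A * √((T : ℝ)⁻¹)) atTop (𝓝 0) := by
    simpa using ((Real.continuous_sqrt.tendsto 0).comp
      (tendsto_inv_atTop_nhds_zero_nat (𝕜 := ℝ))).const_mul (M * A)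
  have h2 : Tendsto (fun T : ℕ => M * N * √(4 * (Real.log T / T))) atTop (𝓝 0) := by
    have hlog : Tendsto (fun T : ℕ => Real.log T / T) atTop (𝓝 0) :=
      Real.isLittleO_log_id_atTop.tendsto_div_nhds_zero.comp tendsto_natCast_atTop_atTop
    have := (Real.continuous_sqrt.tendsto (4 * 0)).comp (hlog.const_mul 4)
    simpa using this.const_mul (M * N)
  have h3 := h1.add h2
  rw [add_zero] at h3
  refine h3.congr fun T => ?_
  rw [one_div_one_div, Real.log_pow, ← mul_div_assoc, Real.sqrt_div' _ (Nat.cast_nonneg T),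
    Real.sqrt_inv]
  push_cast
  ring_nf

end Approachability

end

/-! ### The guarantees of the algorithm -/

open Approachability in
theorem mainTheorem3
    {V : Type*} [NormedAddCommGroup V] [NormedSpace ℝ V] [FiniteDimensional ℝ V]
    {B : Type*} [MeasurableSpace B] {d : ℕ}
    (r : Fin d → B → StrongDual ℝ V) (hr : ∀ i, Measurable (r i))
    (C : ProperCone ℝ (StrongDual ℝ V)) (hC : IsBSet r C)
    (α : V → Fin d → ℝ) (hα : IsOracle r C α)
    (X : Set V) (hX : IsGenerator X (polarCone (C : Set (StrongDual ℝ V))))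
    (h : V → EReal) (hh : IsRegularizer X h)
    (Δ M K : ℝ) (hΔ : 0 < Δ) (hM : 0 < M) (hK : 0 < K)
    (hosc : (⨆ x ∈ X, h x) - (⨅ x ∈ X, h x) ≤ (Δ : EReal))
    (hconv : IsStronglyConvex K h)
    (hbound : ∀ a ∈ stdSimplex ℝ (Fin d), ∀ b : B, ‖mixedPayoff r a b‖ ≤ M)
    {Ω : Type*} [MeasurableSpace Ω] (μ : Measure Ω) [IsProbabilityMeasure μ]
    (a : ℕ → Ω → Fin d → ℝ) (b : ℕ → Ω → B) (i : ℕ → Ω → Fin d)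
    (hplay : IsFTRLPlay μ r h (fun t => √(Δ * K / (M ^ 2 * (t : ℝ)))) α a b i) :
    (∀ T : ℕ, 1 ≤ T →
      Integrable (fun ω => supportFun X (avgPayoff r i b T ω)) μ ∧
        ∫ ω, supportFun X (avgPayoff r i b T ω) ∂μ ≤ 2 * M * √(Δ / (K * (T : ℝ)))) ∧
    (∀ δ : ℝ, 0 < δ → δ < 1 → ∀ T : ℕ, 1 ≤ T →
      1 - δ ≤ μ.real {ω | supportFun X (avgPayoff r i b T ω) ≤
        M / √(T : ℝ) * (2 * √(Δ / K) + setNorm X * √(2 * Real.log (1 / δ)))}) ∧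
    (∀ᵐ ω ∂μ,
      limsup (fun T : ℕ => ((supportFun X (avgPayoff r i b T ω) : ℝ) : EReal)) atTop ≤ 0) := by
  have hne := hX.nonempty
  have hbound' : ∀ j b, ‖r j b‖ ≤ M := norm_payoff_le hbound
  have H := hplay.isSupermartingaleDraw hr hα hX hh hK hconv hbound'
  have hreg : ∀ T : ℕ, 1 ≤ T → ∀ ω, _ := fun T hT ω =>
    supportFun_avgPayoff_le (r := r) (b := b) (i := i) hX.convex hX.isCompact hne hh hΔ hM hK hosc
      hconv hbound' hT ω
  have hmeas : ∀ T, Measurable fun ω => supportFun X (avgPayoff r i b T ω) := fun T =>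
    (continuous_supportFun hX.isCompact hne).measurable.comp (hplay.measurable_avgPayoff hr T)
  have hscale : ∀ T : ℕ, (T : ℝ)⁻¹ * √(T : ℝ) = 1 / √(T : ℝ) := fun T => by
    rw [inv_mul_eq_div, Real.sqrt_div_self']
  have hprob : ∀ δ : ℝ, 0 < δ → δ < 1 → ∀ T : ℕ, 1 ≤ T →
      1 - δ ≤ μ.real {ω | supportFun X (avgPayoff r i b T ω) ≤
        M / √(T : ℝ) * (2 * √(Δ / K) + setNorm X * √(2 * Real.log (1 / δ)))} := by
    intro δ hδ hδ' T hT
    have h1 := H.measureReal_lt_sum_le (mul_nonneg hM.le (setNorm_nonneg X)) hδ hδ' hT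
    have h2 := probReal_add_probReal_compl (μ := μ) (measurableSet_lt
      (measurable_const (a := M * setNorm X * √(T : ℝ) * √(2 * Real.log (1 / δ))))
      (H.measurable_sum T))
    refine (show 1 - δ ≤ _ by linarith).trans (measureReal_mono fun ω hω => ?_)
    rw [Set.mem_compl_iff, Set.mem_ofPred_eq, not_lt] at hω
    rw [Set.mem_ofPred_eq]
    refine (hreg T hT ω).trans ?_
    calc _ ≤ (T : ℝ)⁻¹ * (M * setNorm X * √(T : ℝ) * √(2 * Real.log (1 / δ)) +
          2 * M * √(Δ / K) * √(T : ℝ)) := by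
            gcongr
            exact hω
      _ = ((T : ℝ)⁻¹ * √(T : ℝ)) *
          (M * (2 * √(Δ / K) + setNorm X * √(2 * Real.log (1 / δ)))) := by ring
      _ = _ := by
        rw [hscale T]
        ring
  have hint : ∀ T : ℕ, 1 ≤ T → Integrable (fun ω => supportFun X (avgPayoff r i b T ω)) μ := by
    intro T hT
    have hT0 : (0 : ℝ) < T := by exact_mod_cast hT
    refine .of_bound (hmeas T).aestronglyMeasurable (M * setNorm X)
      (Eventually.of_forall fun ω => ?_)
    refine (abs_supportFun_le hX.isCompact hne _).trans ?_
    gcongr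
    · exact setNorm_nonneg X
    · rw [avgPayoff, norm_smul, norm_inv, Real.norm_natCast, inv_mul_le_iff₀ hT0]
      refine (norm_sum_le_of_le (Finset.Icc 1 T) fun t _ => hbound' (i t ω) (b t ω)).trans_eq ?_
      simp
  refine ⟨fun T hT => ⟨hint T hT, ?_⟩, hprob, ?_⟩
  · refine (integral_mono (hint T hT)
      (((H.integrable_sum T).add (integrable_const _)).const_mul _) (hreg T hT)).trans ?_
    rw [integral_const_mul, integral_add' (H.integrable_sum T) (integrable_const _), integral_const,
      probReal_univ, one_smul]
    calc _ ≤ (T : ℝ)⁻¹ * (0 + 2 * M * √(Δ / K) * √(T : ℝ)) := by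
          gcongr
          exact H.integral_sum_nonpos T
      _ = ((T : ℝ)⁻¹ * √(T : ℝ)) * (2 * M * √(Δ / K)) := by ring
      _ = _ := by
        rw [hscale T, ← div_div, Real.sqrt_div' _ (Nat.cast_nonneg T)]
        ring
  · -- Borel--Cantelli at the confidence levels `1 - 1 / T²`, for `T = n + 2` so that `1 / T² < 1`.
    set β : ℕ → ℝ := fun T => M / √(T : ℝ) *
      (2 * √(Δ / K) + setNorm X * √(2 * Real.log (1 / (1 / (T : ℝ) ^ 2))))
    have hfail : ∀ n : ℕ, μ {ω | β (n + 2) < supportFun X (avgPayoff r i b (n + 2) ω)} ≤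
        ENNReal.ofReal (1 / ((n + 2 : ℕ) : ℝ) ^ 2) := by
      intro n
      have hT : (1 : ℝ) < ((n + 2 : ℕ) : ℝ) := by
        push_cast
        linarith [n.cast_nonneg (α := ℝ)]
      have h1 : 1 - 1 / ((n + 2 : ℕ) : ℝ) ^ 2 ≤
          μ.real {ω | supportFun X (avgPayoff r i b (n + 2) ω) ≤ β (n + 2)} :=
        hprob (1 / ((n + 2 : ℕ) : ℝ) ^ 2) (by positivity)
        ((div_lt_one (by positivity)).2 (one_lt_pow₀ hT two_ne_zero)) (n + 2) (by lia)
      have h2 := probReal_add_probReal_compl (μ := μ)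
        (measurableSet_le (hmeas (n + 2)) (measurable_const (a := β (n + 2))))
      have h3 : {ω | β (n + 2) < supportFun X (avgPayoff r i b (n + 2) ω)} =
          {ω | supportFun X (avgPayoff r i b (n + 2) ω) ≤ β (n + 2)}ᶜ := by
        ext ω
        simp
      rw [h3, ← ofReal_measureReal]
      exact ENNReal.ofReal_le_ofReal (by linarith)
    have hsum : ∑' n : ℕ, μ {ω | β (n + 2) < supportFun X (avgPayoff r i b (n + 2) ω)} ≠ ⊤ := by
      refine ne_top_of_le_ne_top ?_ (ENNReal.tsum_le_tsum hfail)
      exact ((summable_nat_add_iff 2).2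
        (Real.summable_one_div_nat_pow.2 one_lt_two)).tsum_ofReal_ne_top
    filter_upwards [ae_eventually_notMem hsum] with ω hω
    have hlim : Tendsto (fun n : ℕ => ((β (n + 2) : ℝ) : EReal)) atTop (𝓝 ((0 : ℝ) : EReal)) :=
      EReal.tendsto_coe.2 ((tendsto_high_probability_bound M (2 * √(Δ / K)) (setNorm X)).comp
        (tendsto_add_atTop_nat 2))
    rw [← limsup_nat_add _ 2, ← EReal.coe_zero, ← hlim.limsup_eq]
    refine limsup_le_limsup ?_
    filter_upwards [hω] with n hn
    exact_mod_cast not_lt.1 hn
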